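/- Let $k\ge 1$, $[k]=\{1,\dots,k\}$ and $[k]^*=\bigcup_{N\ge 1}[k]^N$. An (infinite-dimensional combinatorial) subspace is a map $\phi:[k]^*\to[k]^*$ specified by integers $0=N_0<N_1<N_2<\cdots$, nonempty sets $I_{i+1}\subseteq [N_{i+1}]\setminus[N_i]$ and words $w_n\in[k]^{N_n}$: for $v\in[k]^n$, $\phi(v)$ is the word of length $N_n$ whose letter at position $m$ is $v_i$ if $m\in I_i$ with $i\le n$, and the $m$-th letter of $w_n$ otherwise. Let $\mathsf A$ be the class of strongly stationary systems: a member is a standard Borel space $(K,\Psi)$ with a probability measure $\mu$ on $(K^{[k]^*},\Psi^{\otimes[k]^*})$ that is invariant under $T_\phi:(x_w)_w\mapsto (x_{\phi(w)})_w$ for every subspace $\phi$. All one-coordinate marginals of such a $\mu$ agree; their common value is the point marginal $\mu^{\rm pt}$ on $K$. A cw-factor map from $(K,\mu)$ to $(L,\nu)$ (in $\mathsf A$) is a map $f^*:(x_w)_w\mapsto(f(x_w))_w$ with $f:K\to L$ Borel and $f^*_\#\mu=\nu$; then $(K,\mu)$ is called a cw-extension of $(L,\nu)$. It is a cw-isomorphism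 if there is a Borel $g:L\to K$ with $g\circ f=\mathrm{id}$ $\mu^{\rm pt}$-a.e. and $f\circ g=\mathrm{id}$ $\nu^{\rm pt}$-a.e. A class $\mathsf C\subseteq\mathsf A$ is cw-idempotent if it contains the trivial (one-point) system and is closed under cw-isomorphisms, under joinings (systems in $\mathsf A$ with cw-factor maps to two members of $\mathsf C$ whose single-coordinate maps together generate the $\sigma$-algebra), and under inverse limits of sequences of members of $\mathsf C$ along cw-factor maps. For a cw-idempotent class $\mathsf C$ and $\mathbf X=(K,\mu)\in\mathsf A$, a map $\zeta_{\mathsf C}$ on $K$ coordinatizes the maximal cw-$\mathsf C$-factor of $\mathbf X$ if $\zeta_{\mathsf C}^*$ is a cw-factor map from $\mathbf X$ to a member of $\mathsf C$ and, for every cw-factor map $f^*$ from $\mathbf X$ to a member of $\mathsf C$, the $\sigma$-algebra generated by $f$ is contained in the one generated by $\zeta_{\mathsf C}$ up to $\mu^{\rm pt}$-negligible sets. The system $\mathbf X$ is cw-$\mathsf C$-sated if for every cw-extension $\pi^*:\tilde{\mathbf X}=(\tilde K,\tilde\mu)\to\mathbf X$ the maximal cw-$\mathsf C$-factor of $\tilde{\mathbf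 X}$ exists and, whenever $\tilde\zeta_{\mathsf C}$ and $\zeta_{\mathsf C}$ coordinatize the maximal cw-$\mathsf C$-factors of $\tilde{\mathbf X}$ and $\mathbf X$, the maps $\pi$ and $\tilde\zeta_{\mathsf C}$ are relatively independent over $\zeta_{\mathsf C}\circ\pi$ under $\tilde\mu^{\rm pt}$, that is, $$\int fg\,d\tilde\mu^{\rm pt}=\int \mathsf E(f\mid\zeta_{\mathsf C}\circ\pi)\,\mathsf E(g\mid\zeta_{\mathsf C}\circ\pi)\,d\tilde\mu^{\rm pt}$$ for all bounded $\pi$-measurable $f$ and bounded $\tilde\zeta_{\mathsf C}$-measurable $g$. Theorem. If $(\mathsf C_i)_{i\in I}$ is a countable family of cw-idempotent classes, then every system $\mathbf X_0\in\mathsf A$ admits a cw-extension $\pi^*:\mathbf X\to\mathbf X_0$ such that $\mathbf X$ is cw-$\mathsf C_i$-sated for every $i\in I$. -/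

import Mathlib

open MeasureTheory

universe u v

namespace StrongStat

/-- The set of all finite words of positive length over the alphabet `[k]`. -/
abbrev Word (k : ℕ) : Type := Σ N : ℕ+, (Fin N → Fin k)

/-- The data `0 = N 0 < N 1 < ...`, nonempty `I i ⊆ [N i, N (i+1))` (positions are counted from `0`)
and words `w n` of length `N n` that specify an infinite-dimensional combinatorial subspace. -/
structure Subspace (k : ℕ) where
  N : ℕ → ℕ
  N_zero : N 0 = 0
  N_strictMono : StrictMono N
  I : ℕ → Finset ℕ
  I_nonempty : ∀ i, (I i).Nonempty
  I_subset : ∀ i, I i ⊆ Finset.Ico (N i) (N (i + 1))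
  w : ∀ n, Fin (N n) → Fin k

namespace Subspace

variable {k : ℕ}

open Classical in
/-- The map on words given by a combinatorial subspace: a word `v` of length `n` goes to the word of
length `N n` whose letter at position `m` is `v i` if `m ∈ I i` with `i < n` (the sets `I i` are
pairwise disjoint) and is the letter of `w n` otherwise. -/
noncomputable def toFun (φ : Subspace k) (v : Word k) : Word k :=
  ⟨⟨φ.N v.1, φ.N_zero ▸ φ.N_strictMono v.1.pos⟩,
    fun m => if h : ∃ i : Fin v.1, (m : ℕ) ∈ φ.I i then v.2 h.choose else φ.w v.1 m⟩

/-- The action `(T_φ x)_w = x_{φ(w)}` on `K^{[k]^*}`. -/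
noncomputable def act {K : Type u} (φ : Subspace k) (x : Word k → K) : Word k → K :=
  fun v => x (φ.toFun v)

end Subspace

/-- A member of the class `A`: a standard Borel space `K` with a strongly stationary probability
measure on the product `K^{[k]^*}` with its product `σ`-algebra. -/
structure System (k : ℕ) : Type (u + 1) where
  K : Type u
  [ms : MeasurableSpace K]
  [standardBorel : StandardBorelSpace K]
  μ : Measure (Word k → K)
  [isProb : IsProbabilityMeasure μ]
  stationary : ∀ φ : Subspace k, μ.map φ.act = μ

attribute [instance] System.ms System.standardBorel System.isProb

variable {k : ℕ}

/-- The one-letter word `a`. -/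
def letter (a : Fin k) : Word k := ⟨1, fun _ => a⟩

/-- The point marginal, the law of a single coordinate (see `System.map_eval`: all coordinates have
the same law). -/
noncomputable def System.pt [NeZero k] (X : System.{u} k) : Measure X.K :=
  X.μ.map (fun x => x (letter 0))

/-- A subspace that sends the one-letter word `w p` to `w`. -/
def lineAt [NeZero k] (w : Word k) (p : Fin w.1) : Subspace k where
  N n := if n = 0 then 0 else w.1 + (n - 1)
  N_zero := by simp
  N_strictMono := by
    refine strictMono_nat_of_lt_succ fun n => ?_
    have := w.1.pos
    rcases n with _ | n <;> simp
  I i := if i = 0 then {(p : ℕ)} else {(w.1 : ℕ) + (i - 1)}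
  I_nonempty i := by split_ifs <;> simp
  I_subset i := by
    have := p.2
    rcases i with _ | i <;> simp
  w n m := if h : (m : ℕ) < w.1 then w.2 ⟨m, h⟩ else 0

lemma lineAt_letter [NeZero k] (w : Word k) (p : Fin w.1) :
    (lineAt w p).toFun (letter (w.2 p)) = w := by
  obtain ⟨N, w⟩ := w
  have h : ∀ m : Fin N, (if _ : ∃ i : Fin 1, (m : ℕ) ∈ (lineAt ⟨N, w⟩ p).I i then w p else w m)
      = w m := by
    intro m
    split_ifs with hm
    · obtain ⟨i, hi⟩ := hm
      obtain rfl := Subsingleton.elim i 0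
      have hmp : (m : ℕ) = p := by simpa [lineAt] using hi
      rw [Fin.ext hmp]
    · rfl
  refine Sigma.ext (PNat.eq rfl) (heq_of_eq (funext fun m => ?_))
  have hm : (m : ℕ) < N := m.2
  refine Eq.trans ?_ (h m)
  simp only [Subspace.toFun, letter]
  split_ifs with h1 h2 h2
  · rfl
  · exact absurd h1 h2
  · exact absurd h2 h1
  · exact dif_pos hm

/-- All one-coordinate marginals of a strongly stationary law agree. -/
theorem System.map_eval [NeZero k] (X : System.{u} k) (w : Word k) :
    X.μ.map (fun x => x w) = X.pt := by
  have key : ∀ (w : Word k) (p : Fin w.1),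
      X.μ.map (fun x => x w) = X.μ.map (fun x => x (letter (w.2 p))) := by
    intro w p
    have hact : Measurable ((lineAt w p).act : (Word k → X.K) → Word k → X.K) :=
      measurable_pi_lambda _ fun v => measurable_pi_apply _
    conv_rhs => rw [← X.stationary (lineAt w p)]
    rw [Measure.map_map (measurable_pi_apply _) hact]
    congr 1
    funext x
    simp [Subspace.act, lineAt_letter]
  have h0 : ∀ a : Fin k, X.μ.map (fun x => x (letter a)) = X.pt := by
    intro a
    have h1 := key ⟨2, ![a, 0]⟩ (0 : Fin 2)
    have h2 := key ⟨2, ![a, 0]⟩ (1 : Fin 2)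
    exact h1.symm.trans h2
  exact (key w ⟨0, w.1.pos⟩).trans (h0 _)

/-- `f` is the single-coordinate map of a cw-factor map `(x_w)_w ↦ (f (x_w))_w` from `X` to `Y`
(such a map commutes with every `T_φ`); equivalently, `X` is a cw-extension of `Y` through it. -/
def IsCwFactorMap (X Y : System.{u} k) (f : X.K → Y.K) : Prop :=
  Measurable f ∧ X.μ.map (fun x w => f (x w)) = Y.μ

/-- `f` is the single-coordinate map of a cw-isomorphism: it is measurably invertible up to
negligible sets for the point marginals. -/
def IsCwIso [NeZero k] (X Y : System.{u} k) (f : X.K → Y.K) : Prop :=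
  IsCwFactorMap X Y f ∧ ∃ g : Y.K → X.K, Measurable g ∧
    (∀ᵐ x ∂X.pt, g (f x) = x) ∧ (∀ᵐ y ∂Y.pt, f (g y) = y)

/-- The law is supported on a single point. -/
def System.IsTrivial (X : System.{u} k) : Prop := ∃ x, X.μ = Measure.dirac x

/-- `Z` is a joining of `X` and `Y` through the cw-factor maps with single-coordinate maps `p`, `q`,
which together generate the `σ`-algebra of `Z`. -/
def IsCwJoining (Z X Y : System.{u} k) (p : Z.K → X.K) (q : Z.K → Y.K) : Prop :=
  IsCwFactorMap Z X p ∧ IsCwFactorMap Z Y q ∧ Z.ms = X.ms.comap p ⊔ Y.ms.comap q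

/-- `Z`, with the cw-factor maps `p n` to the `X n`, is the inverse limit of the inverse sequence of
the `X n` with connecting cw-factor maps `ψ n : X (n + 1) → X n`. -/
def IsCwInverseLimit (Z : System.{u} k) (X : ℕ → System.{u} k)
    (ψ : ∀ n, (X (n + 1)).K → (X n).K) (p : ∀ n, Z.K → (X n).K) : Prop :=
  (∀ n, IsCwFactorMap (X (n + 1)) (X n) (ψ n)) ∧ (∀ n, IsCwFactorMap Z (X n) (p n)) ∧
    (∀ n, ψ n ∘ p (n + 1) = p n) ∧ Z.ms = ⨆ n, (X n).ms.comap (p n)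

/-- A cw-idempotent class: it contains the trivial system and is closed under cw-isomorphisms, under
joinings, and under inverse limits along cw-factor maps. -/
structure IsCwIdempotent [NeZero k] (C : Set (System.{u} k)) : Prop where
  trivial_mem : ∃ X ∈ C, X.IsTrivial
  iso_mem : ∀ (X Y : System.{u} k) (f : X.K → Y.K), X ∈ C → IsCwIso X Y f → Y ∈ C
  joining_mem : ∀ (Z X Y : System.{u} k) (p : Z.K → X.K) (q : Z.K → Y.K),
    X ∈ C → Y ∈ C → IsCwJoining Z X Y p q → Z ∈ C
  inverseLimit_mem : ∀ (Z : System.{u} k) (X : ℕ → System.{u} k)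
    (ψ : ∀ n, (X (n + 1)).K → (X n).K) (p : ∀ n, Z.K → (X n).K),
    (∀ n, X n ∈ C) → IsCwInverseLimit Z X ψ p → Z ∈ C

/-- `ζ : X → Y` coordinatizes the maximal cw-`C`-factor of `X`: `Y ∈ C`, and up to negligible sets
the `σ`-algebra generated by `ζ` contains the one generated by any cw-factor map from `X` to a member
of `C`. -/
def IsMaximalCwFactor [NeZero k] (C : Set (System.{u} k)) (X Y : System.{u} k)
    (ζ : X.K → Y.K) : Prop :=
  Y ∈ C ∧ IsCwFactorMap X Y ζ ∧
    ∀ (Y' : System.{u} k) (f : X.K → Y'.K), Y' ∈ C → IsCwFactorMap X Y' f →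
      ∀ A : Set Y'.K, MeasurableSet A →
        ∃ B : Set Y.K, MeasurableSet B ∧ f ⁻¹' A =ᵐ[X.pt] ζ ⁻¹' B

/-- The `σ`-algebras `m₁`, `m₂` are relatively independent over `m` under `μ`. -/
def RelIndep {Ω : Type u} [MeasurableSpace Ω] (μ : Measure Ω) (m₁ m₂ m : MeasurableSpace Ω) : Prop :=
  ∀ f g : Ω → ℝ, Measurable[m₁] f → Measurable[m₂] g →
    (∃ c, ∀ x, |f x| ≤ c) → (∃ c, ∀ x, |g x| ≤ c) →
    ∫ x, f x * g x ∂μ = ∫ x, (μ[f | m]) x * (μ[g | m]) x ∂μ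

/-- `X` is cw-`C`-sated: for every cw-extension `π : X' → X` the maximal cw-`C`-factor of `X'` exists
(take `π = id` for that of `X`), and whichever maps `ζ'`, `ζ` coordinatize the maximal cw-`C`-factors
of `X'`, `X`, the maps `π` and `ζ'` are relatively independent over `ζ ∘ π` under the point marginal
of `X'`. -/
def IsCwSated [NeZero k] (C : Set (System.{u} k)) (X : System.{u} k) : Prop :=
  ∀ (X' : System.{u} k) (π : X'.K → X.K), IsCwFactorMap X' X π →
    (∃ (Y' : System.{u} k) (ζ' : X'.K → Y'.K), IsMaximalCwFactor C X' Y' ζ') ∧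
    ∀ (Y' Y : System.{u} k) (ζ' : X'.K → Y'.K) (ζ : X.K → Y.K),
      IsMaximalCwFactor C X' Y' ζ' → IsMaximalCwFactor C X Y ζ →
      RelIndep X'.pt (X.ms.comap π) (Y'.ms.comap ζ') (Y.ms.comap (ζ ∘ π))

end StrongStat

/-!
The proof measures how much of a set `A ⊆ K` the class `C` sees in a system: the energy of `A`
relative to a factor is the squared `L²` norm of the conditional expectation of `1_A` on it. Energy
grows with the factor, is unchanged under pull-back to an extension (`IsCwFactorMap.energy_comap`),
and if it stays the same from `m` to a larger `m'`, then the two conditional expectations of `1_A`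
agree, so `A` is orthogonal to the remainders `g - E(g | m)` of all `m'`-measurable `g`
(`setIntegral_sub_condExp_eq_zero`).

*Maximal factors exist* (`IsCwIdempotent.exists_isMaximalCwFactor`). Closure under joinings and
inverse limits makes a cw-idempotent class closed under countable joinings
(`IsCwIdempotent.factor_pi_mem`). Joining factors whose energies approach the supremum for each set
of a countable generating `π`-system gives a factor whose energies no factor in `C` can increase; it
is maximal by the orthogonality above.

*Sated extensions.* Starting from `X₀`, build a tower of extensions. Each step treats one set, taken
from a countable generating `π`-system of an earlier system and pulled back, and one class: the next
extension makes the energy of the set relative to a factor in that class nearly as large as it is in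
any extension at all. Every pair of a set and a class is treated infinitely often, with errors that
tend to zero. The inverse limit of the tower (`exists_isCwInverseLimit`, which rests on the
Ionescu-Tulcea theorem) is an extension of every system of the tower, so none of these sets can gain
energy in an extension of the limit. Since they generate, orthogonality extends to all sets of the
limit by `λ`-system arguments, and this orthogonality is relative independence
(`IsCwInverseLimit.isCwSated`, `relIndep_of_setIntegral_eq_zero`).
-/

namespace StrongStat

/-! ### Conditional expectations in `L²` -/

section CondExp

variable {Ω : Type u} {m m' m₀ : MeasurableSpace Ω} {μ : Measure Ω} [IsProbabilityMeasure μ]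

theorem integral_condExp_mul {f g : Ω → ℝ} (hm : m ≤ m₀) (hf : MemLp f 2 μ) (hg : MemLp g 2 μ)
    (hgm : AEStronglyMeasurable[m] g μ) : ∫ x, (μ[f | m]) x * g x ∂μ = ∫ x, f x * g x ∂μ := by
  have h := condExp_mul_of_aestronglyMeasurable_right (m := m) hgm (hf.integrable_mul hg)
    (hf.integrable one_le_two)
  rw [← integral_condExp (f := fun x => f x * g x) hm]
  exact integral_congr_ae h.symm

theorem integral_condExp_sq {f : Ω → ℝ} (hm : m ≤ m₀) (hf : MemLp f 2 μ) :
    ∫ x, (μ[f | m]) x ^ 2 ∂μ = ∫ x, f x * (μ[f | m]) x ∂μ := by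
  simp_rw [pow_two]
  exact integral_condExp_mul hm hf (hf.condExp one_le_two)
    stronglyMeasurable_condExp.aestronglyMeasurable

theorem integral_condExp_mul_condExp {f g : Ω → ℝ} (hm : m ≤ m₀) (hf : MemLp f 2 μ)
    (hg : MemLp g 2 μ) :
    ∫ x, (μ[f | m]) x * (μ[g | m]) x ∂μ = ∫ x, f x * (μ[g | m]) x ∂μ :=
  integral_condExp_mul hm hf (hg.condExp one_le_two)
    stronglyMeasurable_condExp.aestronglyMeasurable

theorem integral_sub_condExp_eq_zero (hm : m ≤ m₀) {g : Ω → ℝ} (hg : Integrable g μ) :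
    ∫ x, (g x - (μ[g | m]) x) ∂μ = 0 := by
  rw [integral_sub hg integrable_condExp, integral_condExp hm, sub_self]

/-- Pythagoras for the orthogonal decomposition of `f` into `μ[f | m]` and the remainder. -/
theorem integral_sub_condExp_sq {f : Ω → ℝ} (hm : m ≤ m₀) (hf : MemLp f 2 μ) :
    ∫ x, (f x - (μ[f | m]) x) ^ 2 ∂μ = ∫ x, f x ^ 2 ∂μ - ∫ x, (μ[f | m]) x ^ 2 ∂μ := by
  have hc : MemLp (μ[f | m]) 2 μ := hf.condExp one_le_two
  have h1 : ∀ x, (f x - (μ[f | m]) x) ^ 2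
      = f x ^ 2 - 2 * (f x * (μ[f | m]) x) + (μ[f | m]) x ^ 2 := fun x => by ring
  simp_rw [h1]
  have hi : Integrable (fun x => f x * (μ[f | m]) x) μ := hf.integrable_mul hc
  rw [integral_add (f := fun x => f x ^ 2 - 2 * (f x * (μ[f | m]) x))
      (hf.integrable_sq.sub (hi.const_mul 2)) hc.integrable_sq,
    integral_sub hf.integrable_sq (hi.const_mul 2), integral_const_mul,
    integral_condExp_sq hm hf]
  ring

theorem integral_condExp_sq_le {f : Ω → ℝ} (hm : m ≤ m₀) (hf : MemLp f 2 μ) :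
    ∫ x, (μ[f | m]) x ^ 2 ∂μ ≤ ∫ x, f x ^ 2 ∂μ := by
  have h := integral_sub_condExp_sq hm hf
  have : 0 ≤ ∫ x, (f x - (μ[f | m]) x) ^ 2 ∂μ := integral_nonneg fun x => sq_nonneg _
  linarith

/-- If `m` is contained in `m'` up to negligible sets, conditioning on `m'` first does not change
the conditional expectation on `m`. -/
theorem condExp_condExp_of_ae_le {f : Ω → ℝ} (hm : m ≤ m₀) (hm' : m' ≤ m₀) (hf : Integrable f μ)
    (h : ∀ A, MeasurableSet[m] A → ∃ B, MeasurableSet[m'] B ∧ A =ᵐ[μ] B) :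
    μ[μ[f | m'] | m] =ᵐ[μ] μ[f | m] := by
  refine ae_eq_condExp_of_forall_setIntegral_eq hm hf
    (fun _ _ _ => integrable_condExp.integrableOn) (fun A hA _ => ?_)
    stronglyMeasurable_condExp.aestronglyMeasurable
  obtain ⟨B, hB, hAB⟩ := h A hA
  rw [setIntegral_condExp hm integrable_condExp hA, setIntegral_congr_set hAB,
    setIntegral_condExp hm' hf hB, setIntegral_congr_set hAB]

theorem integral_condExp_sq_mono_of_ae_le {f : Ω → ℝ} (hm : m ≤ m₀) (hm' : m' ≤ m₀)
    (hf : MemLp f 2 μ) (h : ∀ A, MeasurableSet[m] A → ∃ B, MeasurableSet[m'] B ∧ A =ᵐ[μ] B) :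
    ∫ x, (μ[f | m]) x ^ 2 ∂μ ≤ ∫ x, (μ[f | m']) x ^ 2 ∂μ := by
  have h1 := condExp_condExp_of_ae_le hm hm' (hf.integrable one_le_two) h
  rw [← integral_congr_ae (h1.mono fun x hx => congrArg (· ^ 2) hx)]
  exact integral_condExp_sq_le hm (hf.condExp one_le_two)

theorem integral_condExp_sq_mono {f : Ω → ℝ} (hmm' : m ≤ m') (hm' : m' ≤ m₀)
    (hf : MemLp f 2 μ) :
    ∫ x, (μ[f | m]) x ^ 2 ∂μ ≤ ∫ x, (μ[f | m']) x ^ 2 ∂μ :=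
  integral_condExp_sq_mono_of_ae_le (hmm'.trans hm') hm' hf
    fun A hA => ⟨A, hmm' A hA, ae_eq_refl A⟩

/-- Conditional expectations on nested `σ`-algebras whose `L²` norms agree are equal. -/
theorem condExp_ae_eq_of_integral_sq_le {f : Ω → ℝ} (hmm' : m ≤ m') (hm' : m' ≤ m₀)
    (hf : MemLp f 2 μ) (h : ∫ x, (μ[f | m']) x ^ 2 ∂μ ≤ ∫ x, (μ[f | m]) x ^ 2 ∂μ) :
    μ[f | m'] =ᵐ[μ] μ[f | m] := by
  have hc : MemLp (μ[f | m']) 2 μ := hf.condExp one_le_two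
  have htow : μ[μ[f | m'] | m] =ᵐ[μ] μ[f | m] := condExp_condExp_of_le hmm' hm'
  have h1 := integral_sub_condExp_sq (hmm'.trans hm') hc
  rw [integral_congr_ae (htow.mono fun x hx => congrArg (· ^ 2) hx)] at h1
  have h0 : 0 ≤ ∫ x, ((μ[f | m']) x - (μ[μ[f | m'] | m]) x) ^ 2 ∂μ :=
    integral_nonneg fun x => sq_nonneg _
  have h2 : ∫ x, ((μ[f | m']) x - (μ[μ[f | m'] | m]) x) ^ 2 ∂μ = 0 := by linarith
  have hi : Integrable (fun x => ((μ[f | m']) x - (μ[μ[f | m'] | m]) x) ^ 2) μ :=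
    (hc.sub (hc.condExp one_le_two)).integrable_sq
  rw [integral_eq_zero_iff_of_nonneg (fun x => sq_nonneg _) hi] at h2
  filter_upwards [h2, htow] with x hx hx'
  have : (μ[f | m']) x - (μ[μ[f | m'] | m]) x = 0 := by simpa using hx
  linarith

omit [IsProbabilityMeasure μ] in
/-- The sets on which an integrable function has vanishing integral form a `λ`-system. -/
theorem setIntegral_eq_zero_of_piSystem {h : Ω → ℝ} (hh : Integrable h μ) {S : Set (Set Ω)}
    (hS : IsPiSystem S) {m₁ : MeasurableSpace Ω} (hm₁ : m₁ ≤ m₀)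
    (hgen : m₁ = MeasurableSpace.generateFrom S) (huniv : ∫ x, h x ∂μ = 0)
    (hbasic : ∀ A ∈ S, ∫ x in A, h x ∂μ = 0) :
    ∀ A, MeasurableSet[m₁] A → ∫ x in A, h x ∂μ = 0 := by
  refine MeasurableSpace.induction_on_inter (C := fun A _ => ∫ x in A, h x ∂μ = 0) hgen hS
    (by simp) hbasic (fun A hA hA0 => ?_) (fun A hd hA hA0 => ?_)
  · have := integral_add_compl (hm₁ _ hA) hh
    linarith
  · rw [integral_iUnion (fun i => hm₁ _ (hA i)) hd hh.integrableOn]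
    simp [hA0]

/-- If an integrable function has vanishing integral over all sets of `m₁`, it is orthogonal to all
bounded `m₁`-measurable functions. -/
theorem integral_mul_eq_zero_of_setIntegral {h : Ω → ℝ} (hh : MemLp h 2 μ)
    {m₁ : MeasurableSpace Ω} (hm₁ : m₁ ≤ m₀)
    (h0 : ∀ A, MeasurableSet[m₁] A → ∫ x in A, h x ∂μ = 0) {f : Ω → ℝ}
    (hf : StronglyMeasurable[m₁] f) (hf2 : MemLp f 2 μ) : ∫ x, f x * h x ∂μ = 0 := by
  have hz : (0 : Ω → ℝ) =ᵐ[μ] μ[h | m₁] :=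
    ae_eq_condExp_of_forall_setIntegral_eq hm₁ (hh.integrable one_le_two)
      (fun _ _ _ => (integrable_zero _ _ _).integrableOn) (fun A hA _ => by simp [h0 A hA])
      aestronglyMeasurable_zero
  have h1 := integral_condExp_mul hm₁ hh hf2 hf.aestronglyMeasurable
  simp_rw [mul_comm (f _), ← h1]
  rw [integral_eq_zero_of_ae]
  filter_upwards [hz] with x hx
  simp [← hx]

/-- If passing from `m` to a larger `m'` does not increase the `L²` norm of the conditional
expectation of `1_A`, then `A` is orthogonal to the remainders `g - μ[g | m]` of the
`m'`-measurable functions `g`. -/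
theorem setIntegral_sub_condExp_eq_zero {A : Set Ω} (hA : MeasurableSet A) (hmm' : m ≤ m')
    (hm' : m' ≤ m₀)
    (h : ∫ x, (μ[A.indicator 1 | m']) x ^ 2 ∂μ ≤ ∫ x, (μ[A.indicator (1 : Ω → ℝ) | m]) x ^ 2 ∂μ)
    {g : Ω → ℝ} (hg : StronglyMeasurable[m'] g) (hg2 : MemLp g 2 μ) :
    ∫ x in A, (g x - (μ[g | m]) x) ∂μ = 0 := by
  have hA2 : MemLp (A.indicator (1 : Ω → ℝ)) 2 μ := memLp_indicator_const 2 hA 1 (by simp)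
  have heq := condExp_ae_eq_of_integral_sq_le hmm' hm' hA2 h
  have hgc : MemLp (μ[g | m]) 2 μ := hg2.condExp one_le_two
  have hset : ∀ f : Ω → ℝ, ∫ x in A, f x ∂μ = ∫ x, A.indicator 1 x * f x ∂μ := fun f => by
    rw [← integral_indicator hA]
    congr 1 with x
    by_cases hx : x ∈ A <;> simp [hx]
  rw [integral_sub (hg2.integrable one_le_two).integrableOn
    (hgc.integrable one_le_two).integrableOn, hset, hset,
    ← integral_condExp_mul hm' hA2 hg2 hg.aestronglyMeasurable,
    ← integral_condExp_mul_condExp (hmm'.trans hm') hA2 hg2, sub_eq_zero]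
  have h2 := integral_condExp_mul_condExp (hmm'.trans hm') hg2 hA2
  simp_rw [mul_comm ((μ[A.indicator (1 : Ω → ℝ) | m]) _), h2]
  refine integral_congr_ae ?_
  filter_upwards [heq] with x hx
  rw [hx, mul_comm]

/-- Orthogonality of all sets of `m₁` to the remainders of the `m₂`-measurable functions over `m` is
relative independence. -/
theorem relIndep_of_setIntegral_eq_zero {Ω : Type u} {m₁ m₂ m m₀ : MeasurableSpace Ω}
    {μ : Measure Ω} [IsProbabilityMeasure μ] (hm₁ : m₁ ≤ m₀) (hm₂ : m₂ ≤ m₀) (hm : m ≤ m₀)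
    (h : ∀ g : Ω → ℝ, StronglyMeasurable[m₂] g → MemLp g 2 μ →
      ∀ A, MeasurableSet[m₁] A → ∫ x in A, (g x - (μ[g | m]) x) ∂μ = 0) :
    RelIndep μ m₁ m₂ m := by
  rintro f g hf hg ⟨c, hc⟩ ⟨d, hd⟩
  have hf2 : MemLp f 2 μ :=
    MemLp.of_bound (hf.mono hm₁ le_rfl).aestronglyMeasurable c (ae_of_all _ hc)
  have hg2 : MemLp g 2 μ :=
    MemLp.of_bound (hg.mono hm₂ le_rfl).aestronglyMeasurable d (ae_of_all _ hd)
  have hgc : MemLp (μ[g | m]) 2 μ := hg2.condExp one_le_two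
  have h0 := integral_mul_eq_zero_of_setIntegral (h := fun x => g x - (μ[g | m]) x)
    (hg2.sub hgc) hm₁ (h g hg.stronglyMeasurable hg2) hf.stronglyMeasurable hf2
  simp_rw [mul_sub] at h0
  have hi : Integrable (fun x => f x * g x) μ := hf2.integrable_mul hg2
  have hi' : Integrable (fun x => f x * (μ[g | m]) x) μ := hf2.integrable_mul hgc
  rw [integral_sub hi hi', sub_eq_zero] at h0
  rw [h0, integral_condExp_mul_condExp hm hf2 hg2]

/-- Conditional expectations commute with pull-back along a measure-preserving map. -/
theorem condExp_comp_of_map {Ω' : Type v} {m₁ n₀ : MeasurableSpace Ω'} {ν : Measure Ω'}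
    [IsProbabilityMeasure ν] {π : Ω → Ω'} (hπ : Measurable π) (hmap : μ.map π = ν)
    (hm₁ : m₁ ≤ n₀) {f : Ω' → ℝ} (hf : Integrable f ν) :
    μ[f ∘ π | m₁.comap π] =ᵐ[μ] (ν[f | m₁]) ∘ π := by
  have hle : m₁.comap π ≤ m₀ := (MeasurableSpace.comap_mono hm₁).trans hπ.comap_le
  have hint : ∀ {g : Ω' → ℝ}, Integrable g ν → Integrable (g ∘ π) μ := fun {g} hg => by
    rw [← hmap] at hg
    exact hg.comp_measurable hπ
  refine (ae_eq_condExp_of_forall_setIntegral_eq hle (hint hf)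
    (fun _ _ _ => (hint integrable_condExp).integrableOn) ?_ ?_).symm
  · rintro _ ⟨B, hB, rfl⟩ -
    have h1 : ∀ {g : Ω' → ℝ}, Integrable g ν →
        ∫ x in π ⁻¹' B, (g ∘ π) x ∂μ = ∫ y in B, g y ∂ν := fun {g} hg => by
      rw [← hmap] at hg ⊢
      rw [setIntegral_map (hm₁ _ hB) hg.aestronglyMeasurable hπ.aemeasurable]
      rfl
    rw [h1 integrable_condExp, h1 hf, setIntegral_condExp hm₁ hf hB]
  · exact (stronglyMeasurable_condExp.comp_measurable
      (comap_measurable π)).aestronglyMeasurable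

theorem integral_condExp_sq_comp_of_map {Ω' : Type v} {m₁ n₀ : MeasurableSpace Ω'} {ν : Measure Ω'}
    [IsProbabilityMeasure ν] {π : Ω → Ω'} (hπ : Measurable π) (hmap : μ.map π = ν)
    (hm₁ : m₁ ≤ n₀) {f : Ω' → ℝ} (hf : Integrable f ν) :
    ∫ x, (μ[f ∘ π | m₁.comap π]) x ^ 2 ∂μ = ∫ y, (ν[f | m₁]) y ^ 2 ∂ν := by
  rw [integral_congr_ae
    ((condExp_comp_of_map hπ hmap hm₁ hf).mono fun x hx => congrArg (· ^ 2) hx)]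
  subst hmap
  have hsm : AEStronglyMeasurable (fun y => ((μ.map π)[f | m₁]) y ^ 2) (μ.map π) :=
    ((stronglyMeasurable_condExp.mono hm₁).pow 2).aestronglyMeasurable
  exact (integral_map hπ.aemeasurable hsm).symm

end CondExp

/-! ### Inverse limits of probability spaces -/

open ProbabilityTheory in
theorem map_compProd_comap {α β γ : Type*} [MeasurableSpace α] [MeasurableSpace β]
    [MeasurableSpace γ] (ν : Measure α) [SFinite ν] (η : Kernel β γ)
    [IsSFiniteKernel η] {X : α → β} (hX : Measurable X) :
    (ν ⊗ₘ η.comap X hX).map (Prod.map X id) = ν.map X ⊗ₘ η := by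
  ext s hs
  rw [Measure.map_apply (hX.prodMap measurable_id) hs,
    Measure.compProd_apply (hX.prodMap measurable_id hs), Measure.compProd_apply hs,
    lintegral_map (Kernel.measurable_kernel_prodMk_left hs) hX]
  rfl

open ProbabilityTheory in
/-- An inverse sequence of standard Borel probability spaces has an inverse limit, realized as a law
on sequences that are almost surely compatible: it is the law of the Markov chain whose transition
from time `n` to time `n + 1` is the disintegration of `μ (n + 1)` over `μ n`. -/
theorem exists_inverseLimit_measure {Ω : ℕ → Type u} [∀ n, MeasurableSpace (Ω n)]
    [∀ n, StandardBorelSpace (Ω n)] (μ : ∀ n, Measure (Ω n)) [∀ n, IsProbabilityMeasure (μ n)]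
    (ψ : ∀ n, Ω (n + 1) → Ω n) (hψ : ∀ n, Measurable (ψ n))
    (hmap : ∀ n, (μ (n + 1)).map (ψ n) = μ n) :
    ∃ P : Measure (∀ n, Ω n), IsProbabilityMeasure P ∧ (∀ n, P.map (fun x => x n) = μ n) ∧
      ∀ n, ∀ᵐ x ∂P, ψ n (x (n + 1)) = x n := by
  have hne : ∀ n, Nonempty (Ω n) := fun n => nonempty_of_isProbabilityMeasure (μ n)
  let η : ∀ n, Kernel (Ω n) (Ω (n + 1)) := fun n => condDistrib id (ψ n) (μ (n + 1))
  let κ : ∀ n, Kernel (∀ i : Finset.Iic n, Ω i) (Ω (n + 1)) := fun n =>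
    (η n).comap (fun x => x ⟨n, Finset.mem_Iic.2 le_rfl⟩) (measurable_pi_apply _)
  have hη : ∀ n, (μ n) ⊗ₘ η n = (μ (n + 1)).map (fun a => (ψ n a, a)) := fun n => by
    have := compProd_map_condDistrib (μ := μ (n + 1)) (X := ψ n) (Y := id) (mβ := inferInstance)
      aemeasurable_id
    rwa [hmap] at this
  let P := Kernel.trajMeasure (μ 0) κ
  have hpair : ∀ n, P.map (fun x => x n) = μ n →
      P.map (fun x => (x n, x (n + 1))) = (μ (n + 1)).map (fun a => (ψ n a, a)) := by
    intro n hn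
    have h := Kernel.map_frestrictLe_trajMeasure_compProd_eq_map_trajMeasure
      (μ₀ := μ 0) (κ := κ) (a := n)
    have hr : Measurable (fun x : ∀ i : Finset.Iic n, Ω i => x ⟨n, Finset.mem_Iic.2 le_rfl⟩) :=
      measurable_pi_apply _
    have h2 := congrArg (Measure.map (Prod.map
      (fun x : ∀ i : Finset.Iic n, Ω i => x ⟨n, Finset.mem_Iic.2 le_rfl⟩) id)) h
    rw [map_compProd_comap _ _ hr, Measure.map_map hr (by fun_prop),
      Measure.map_map (hr.prodMap measurable_id) (by fun_prop)] at h2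
    rw [← hη n, ← hn]
    exact h2.symm
  have hmarg : ∀ n, P.map (fun x => x n) = μ n := by
    intro n
    induction n with
    | zero =>
      let ι : Ω 0 → ∀ i : Finset.Iic 0, Ω i :=
        (MeasurableEquiv.piUnique fun i : Finset.Iic 0 => Ω i).symm
      have hι : Measurable ι :=
        (MeasurableEquiv.piUnique fun i : Finset.Iic 0 => Ω i).symm.measurable
      have h1 : P.map (Preorder.frestrictLe 0) = (μ 0).map ι := by
        rw [show P = Kernel.trajMeasure (μ 0) κ from rfl, Kernel.trajMeasure,
          Measure.map_comp _ _ (by fun_prop), Kernel.traj_map_frestrictLe,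
          Kernel.partialTraj_self, Measure.id_comp]
        rfl
      have h2 := congrArg (Measure.map fun x : ∀ i : Finset.Iic 0, Ω i =>
        x ⟨0, Finset.mem_Iic.2 le_rfl⟩) h1
      rw [Measure.map_map (measurable_pi_apply _) (by fun_prop),
        Measure.map_map (measurable_pi_apply _) hι] at h2
      exact h2.trans Measure.map_id
    | succ n ih =>
      have h := congrArg (Measure.map Prod.snd) (hpair n ih)
      rw [Measure.map_map measurable_snd (by fun_prop),
        Measure.map_map measurable_snd ((hψ n).prodMk measurable_id')] at h
      exact h.trans Measure.map_id
  refine ⟨P, inferInstance, hmarg, fun n => ?_⟩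
  have hm : Measurable fun x : ∀ n, Ω n => (x n, x (n + 1)) := by fun_prop
  have hset : MeasurableSet {p : Ω n × Ω (n + 1) | ψ n p.2 = p.1} :=
    measurableSet_eq_fun ((hψ n).comp measurable_snd) measurable_fst
  have h1 : ∀ᵐ p ∂(P.map fun x => (x n, x (n + 1))), ψ n p.2 = p.1 := by
    rw [hpair n (hmarg n), ae_map_iff ((hψ n).prodMk measurable_id').aemeasurable hset]
    exact ae_of_all _ fun _ => rfl
  exact (ae_map_iff hm.aemeasurable hset).1 h1

/-! ### Factors, joinings and inverse limits of systems -/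

variable {k : ℕ}

theorem measurable_coordMap {α K L : Type*} [MeasurableSpace K] [MeasurableSpace L] {f : K → L}
    (hf : Measurable f) : Measurable fun (x : α → K) a => f (x a) :=
  measurable_pi_lambda _ fun a => hf.comp (measurable_pi_apply a)

theorem Subspace.measurable_act {K : Type u} [MeasurableSpace K] (φ : Subspace k) :
    Measurable (φ.act : (Word k → K) → Word k → K) :=
  measurable_pi_lambda _ fun _ => measurable_pi_apply _

instance System.isProbabilityMeasure_pt [NeZero k] (X : System.{u} k) :
    IsProbabilityMeasure X.pt :=
  Measure.isProbabilityMeasure_map (measurable_pi_apply _).aemeasurable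

theorem System.nonempty_K [NeZero k] (X : System.{u} k) : Nonempty X.K :=
  nonempty_of_isProbabilityMeasure X.pt

/-- The factor of `X` coordinatized by a measurable map `f` on `X.K`. -/
noncomputable def System.factor (X : System.{u} k) {L : Type u} [MeasurableSpace L]
    [StandardBorelSpace L] {f : X.K → L} (hf : Measurable f) : System.{u} k where
  K := L
  μ := X.μ.map fun x w => f (x w)
  isProb := Measure.isProbabilityMeasure_map (measurable_coordMap hf).aemeasurable
  stationary φ := by
    rw [Measure.map_map φ.measurable_act (measurable_coordMap hf)]
    conv_rhs => rw [← X.stationary φ, Measure.map_map (measurable_coordMap hf) φ.measurable_act]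
    rfl

theorem System.isCwFactorMap_factor (X : System.{u} k) {L : Type u} [MeasurableSpace L]
    [StandardBorelSpace L] {f : X.K → L} (hf : Measurable f) :
    IsCwFactorMap X (X.factor hf) f :=
  ⟨hf, rfl⟩

theorem System.isCwFactorMap_factor_factor (X : System.{u} k) {L M : Type u} [MeasurableSpace L]
    [StandardBorelSpace L] [MeasurableSpace M] [StandardBorelSpace M] {f : X.K → L} {g : X.K → M}
    (hf : Measurable f) (hg : Measurable g) {h : L → M} (hh : Measurable h) (hhf : h ∘ f = g) :
    IsCwFactorMap (X.factor hf) (X.factor hg) h := by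
  subst hhf
  exact ⟨hh, Measure.map_map (measurable_coordMap hh) (measurable_coordMap hf)⟩

theorem IsCwFactorMap.factor_eq {X Y : System.{u} k} {f : X.K → Y.K} (h : IsCwFactorMap X Y f) :
    X.factor h.1 = Y := by
  obtain ⟨L, ν, hν⟩ := Y
  obtain ⟨hf, hμ⟩ := h
  change X.K → L at f
  change X.μ.map (fun x w => f (x w)) = ν at hμ
  subst hμ
  rfl

theorem IsCwFactorMap.id (X : System.{u} k) : IsCwFactorMap X X id :=
  ⟨measurable_id, Measure.map_id⟩

theorem IsCwFactorMap.comp {X Y Z : System.{u} k} {f : X.K → Y.K} {g : Y.K → Z.K}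
    (hg : IsCwFactorMap Y Z g) (hf : IsCwFactorMap X Y f) : IsCwFactorMap X Z (g ∘ f) := by
  refine ⟨hg.1.comp hf.1, ?_⟩
  rw [← hg.2, ← hf.2, Measure.map_map (measurable_coordMap hg.1) (measurable_coordMap hf.1)]
  rfl

theorem IsCwFactorMap.map_pt [NeZero k] {X Y : System.{u} k} {f : X.K → Y.K}
    (h : IsCwFactorMap X Y f) : X.pt.map f = Y.pt := by
  rw [System.pt, System.pt, ← h.2, Measure.map_map h.1 (measurable_pi_apply (letter 0)),
    Measure.map_map (measurable_pi_apply (letter 0)) (measurable_coordMap h.1)]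
  rfl

theorem System.pt_eq_dirac [NeZero k] {X : System.{u} k} {x : Word k → X.K}
    (hx : X.μ = Measure.dirac x) : X.pt = Measure.dirac (x (letter 0)) := by
  rw [System.pt, hx]
  exact Measure.map_dirac' (measurable_pi_apply (letter 0)) x

/-- A one-point factor of any system is cw-isomorphic to the trivial member of the class, whose
underlying space may have more points. -/
theorem IsCwIdempotent.factor_mem_of_subsingleton [NeZero k] {C : Set (System.{u} k)}
    (hC : IsCwIdempotent C) (X : System.{u} k) {L : Type u} [MeasurableSpace L]
    [StandardBorelSpace L] [Subsingleton L] {f : X.K → L} (hf : Measurable f) :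
    X.factor hf ∈ C := by
  obtain ⟨T, hT, t, ht⟩ := hC.trivial_mem
  obtain ⟨x₀⟩ := X.nonempty_K
  have hprob : ∀ P Q : Measure (Word k → L), IsProbabilityMeasure P → IsProbabilityMeasure Q →
      P = Q := by
    intro P Q hP hQ
    ext s -
    obtain rfl | hs := s.eq_empty_or_nonempty
    · simp
    · rw [Subsingleton.eq_univ_of_nonempty hs, measure_univ, measure_univ]
  have hm : Measurable fun _ : T.K => f x₀ := measurable_const
  refine hC.iso_mem T (X.factor hf) (fun _ => f x₀) hT ⟨⟨measurable_const, ?_⟩,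
    fun _ => t (letter 0), measurable_const, ?_, ?_⟩
  · exact hprob _ _ (Measure.isProbabilityMeasure_map (measurable_coordMap hm).aemeasurable)
      (X.factor hf).isProb
  · rw [System.pt_eq_dirac ht]
    exact (ae_dirac_iff (measurableSet_eq_fun measurable_const measurable_id)).2 rfl
  · exact ae_of_all _ fun y => Subsingleton.elim (α := L) _ _

theorem IsCwIdempotent.factor_prodMk_mem [NeZero k] {C : Set (System.{u} k)}
    (hC : IsCwIdempotent C) (X : System.{u} k) {L M : Type u} [MeasurableSpace L]
    [StandardBorelSpace L] [MeasurableSpace M] [StandardBorelSpace M] {f : X.K → L} {g : X.K → M}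
    (hf : Measurable f) (hg : Measurable g) (hfC : X.factor hf ∈ C) (hgC : X.factor hg ∈ C) :
    X.factor (hf.prodMk hg) ∈ C :=
  hC.joining_mem _ (X.factor hf) (X.factor hg) Prod.fst Prod.snd hfC hgC
    ⟨X.isCwFactorMap_factor_factor _ hf measurable_fst rfl,
      X.isCwFactorMap_factor_factor _ hg measurable_snd rfl, rfl⟩

/-- Each finite joint factor is a joining of the preceding one with one more factor. -/
theorem IsCwIdempotent.factor_pi_fin_mem [NeZero k] {C : Set (System.{u} k)}
    (hC : IsCwIdempotent C) (X : System.{u} k) {L : ℕ → Type u} [∀ n, MeasurableSpace (L n)]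
    [∀ n, StandardBorelSpace (L n)] {f : ∀ n, X.K → L n} (hf : ∀ n, Measurable (f n))
    (hfC : ∀ n, X.factor (hf n) ∈ C) (n : ℕ) :
    X.factor (f := fun x (i : Fin n) => f i x) (measurable_pi_lambda _ fun i => hf i) ∈ C := by
  induction n with
  | zero => exact hC.factor_mem_of_subsingleton X _
  | succ n ih =>
    have hp : Measurable fun (z : ∀ i : Fin (n + 1), L i) (i : Fin n) => z i.castSucc :=
      measurable_pi_lambda _ fun i => measurable_pi_apply _
    have hq : Measurable fun z : ∀ i : Fin (n + 1), L i => z (Fin.last n) :=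
      measurable_pi_apply _
    refine hC.joining_mem _
      (X.factor (f := fun x (i : Fin n) => f i x) (measurable_pi_lambda _ fun i => hf i))
      (X.factor (hf n)) (fun (z : ∀ i : Fin (n + 1), L i) (i : Fin n) => z i.castSucc)
      (fun z : ∀ i : Fin (n + 1), L i => z (Fin.last n)) ih (hfC n)
      ⟨X.isCwFactorMap_factor_factor _ _ hp rfl, X.isCwFactorMap_factor_factor _ _ hq rfl, ?_⟩
    refine le_antisymm (iSup_le fun i => ?_) (sup_le hp.comap_le hq.comap_le)
    induction i using Fin.lastCases with
    | last => exact le_sup_right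
    | cast i =>
      refine le_trans (Measurable.comap_le ?_) le_sup_left
      exact (measurable_pi_apply i).comp
        (comap_measurable fun (z : ∀ i : Fin (n + 1), L i) (i : Fin n) => z i.castSucc)

/-- A cw-idempotent class is closed under countable joinings: the joint factor of countably many
factors of one system is the inverse limit of its finite sub-joinings. -/
theorem IsCwIdempotent.factor_pi_mem [NeZero k] {C : Set (System.{u} k)}
    (hC : IsCwIdempotent C) (X : System.{u} k) {L : ℕ → Type u} [∀ n, MeasurableSpace (L n)]
    [∀ n, StandardBorelSpace (L n)] {f : ∀ n, X.K → L n} (hf : ∀ n, Measurable (f n))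
    (hfC : ∀ n, X.factor (hf n) ∈ C) :
    X.factor (f := fun x n => f n x) (measurable_pi_lambda _ hf) ∈ C := by
  have hp : ∀ n, Measurable fun (z : ∀ i : Fin (n + 1), L i) (i : Fin n) => z i.castSucc :=
    fun n => measurable_pi_lambda _ fun i => measurable_pi_apply _
  have hq : ∀ n, Measurable fun (z : ∀ i, L i) (i : Fin n) => z i :=
    fun n => measurable_pi_lambda _ fun i => measurable_pi_apply _
  refine hC.inverseLimit_mem _
    (fun n => X.factor (f := fun x (i : Fin n) => f i x) (measurable_pi_lambda _ fun i => hf i))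
    (fun n (z : ∀ i : Fin (n + 1), L i) (i : Fin n) => z i.castSucc)
    (fun n (z : ∀ i, L i) (i : Fin n) => z i) (hC.factor_pi_fin_mem X hf hfC)
    ⟨fun n => X.isCwFactorMap_factor_factor _ _ (hp n) rfl,
      fun n => X.isCwFactorMap_factor_factor _ _ (hq n) rfl, fun n => rfl, ?_⟩
  refine le_antisymm (iSup_le fun i => ?_) (iSup_le fun n => (hq n).comap_le)
  refine le_trans (Measurable.comap_le ?_) (le_iSup _ (i + 1))
  exact (measurable_pi_apply (Fin.last i)).comp
    (comap_measurable fun (z : ∀ i, L i) (j : Fin (i + 1)) => z j)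

theorem comap_monotone_of_comp_eq {Z : Type*} {K : ℕ → Type*} [∀ n, MeasurableSpace (K n)]
    {ψ : ∀ n, K (n + 1) → K n} (hψ : ∀ n, Measurable (ψ n)) {p : ∀ n, Z → K n}
    (hp : ∀ n, ψ n ∘ p (n + 1) = p n) :
    Monotone fun n => MeasurableSpace.comap (p n) inferInstance := by
  refine monotone_nat_of_le_succ fun n => ?_
  rw [← hp n, ← MeasurableSpace.comap_comp]
  exact MeasurableSpace.comap_mono (hψ n).comap_le

theorem isPiSystem_iUnion_measurableSet {Z : Type*} {m : ℕ → MeasurableSpace Z}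
    (hm : Monotone m) : IsPiSystem (⋃ n, {s | MeasurableSet[m n] s}) :=
  isPiSystem_iUnion_of_monotone _ (fun n => @MeasurableSpace.isPiSystem_measurableSet _ (m n))
    fun _ _ hab => hm hab

/-- A law on `Z^α`, where `Z` is the inverse limit of the `K n`, is determined by its images on the
spaces `(K n)^α`. -/
theorem ext_of_map_coord {α Z : Type*} {K : ℕ → Type*} [mZ : MeasurableSpace Z]
    [∀ n, MeasurableSpace (K n)]
    {ψ : ∀ n, K (n + 1) → K n} (hψ : ∀ n, Measurable (ψ n)) {p : ∀ n, Z → K n}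
    (hp : ∀ n, ψ n ∘ p (n + 1) = p n)
    (hZ : mZ = ⨆ n, MeasurableSpace.comap (p n) inferInstance)
    (P Q : Measure (α → Z)) [IsProbabilityMeasure P] [IsProbabilityMeasure Q]
    (h : ∀ n, P.map (fun (x : α → Z) a => p n (x a)) = Q.map (fun (x : α → Z) a => p n (x a))) :
    P = Q := by
  have hpm : ∀ n, Measurable (p n) := fun n => by
    rw [measurable_iff_comap_le, hZ]
    exact le_iSup (fun n => MeasurableSpace.comap (p n) inferInstance) n
  let m : ℕ → MeasurableSpace (α → Z) := fun n =>
    MeasurableSpace.comap (fun (x : α → Z) a => p n (x a)) inferInstance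
  have hmono : Monotone m :=
    comap_monotone_of_comp_eq (ψ := fun n (x : α → _) a => ψ n (x a))
      (p := fun n (x : α → _) a => p n (x a))
      (fun n => measurable_coordMap (hψ n)) fun n => by
        funext x a
        exact congrFun (hp n) (x a)
  have hgen : (MeasurableSpace.pi : MeasurableSpace (α → Z)) = ⨆ n, m n := by
    refine le_antisymm (iSup_le fun a => ?_)
      (iSup_le fun n => (measurable_coordMap (hpm n)).comap_le)
    rw [hZ, MeasurableSpace.comap_iSup]
    refine iSup_mono fun n => ?_
    rw [MeasurableSpace.comap_comp]
    refine Measurable.comap_le ?_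
    exact (measurable_pi_apply a).comp (comap_measurable fun (x : α → Z) a => p n (x a))
  rw [← MeasurableSpace.generateFrom_iUnion_measurableSet] at hgen
  refine ext_of_generate_finite _ hgen (isPiSystem_iUnion_measurableSet hmono) ?_ (by simp)
  intro s hs
  obtain ⟨n, t, ht, rfl⟩ := Set.mem_iUnion.1 hs
  rw [← Measure.map_apply (measurable_coordMap (hpm n)) ht, h n,
    Measure.map_apply (measurable_coordMap (hpm n)) ht]

/-- Inverse limits of systems exist. The underlying space consists of the compatible sequences; the
law is that of an almost surely compatible random sequence, moved onto this space, and it is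
stationary because its images on the systems `X n` are. -/
theorem exists_isCwInverseLimit [NeZero k] (X : ℕ → System.{u} k)
    (ψ : ∀ n, (X (n + 1)).K → (X n).K) (hψ : ∀ n, IsCwFactorMap (X (n + 1)) (X n) (ψ n)) :
    ∃ (Z : System.{u} k) (p : ∀ n, Z.K → (X n).K), IsCwInverseLimit Z X ψ p := by
  obtain ⟨P, hP, hmarg, hcompat⟩ := exists_inverseLimit_measure (fun n => (X n).μ)
    (fun n x w => ψ n (x w)) (fun n => measurable_coordMap (hψ n).1) (fun n => (hψ n).2)
  let D : Set (∀ n, (X n).K) := {z | ∀ n, ψ n (z (n + 1)) = z n}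
  have hD : MeasurableSet D := by
    have : D = ⋂ n, {z | ψ n (z (n + 1)) = z n} := by ext; simp [D]
    rw [this]
    exact MeasurableSet.iInter fun n =>
      measurableSet_eq_fun ((hψ n).1.comp (measurable_pi_apply _)) (measurable_pi_apply _)
  have hin : ∀ᵐ x ∂P, ∀ w, (fun n => x n w) ∈ D := by
    filter_upwards [ae_all_iff.2 hcompat] with x hx w n
    exact congrFun (hx n) w
  obtain ⟨x₀, hx₀⟩ := hin.exists
  have hsb : StandardBorelSpace D := hD.standardBorel
  obtain ⟨r, hr, hrD⟩ := hD.exists_measurable_proj ⟨_, hx₀ (letter 0)⟩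
  let p : ∀ n, D → (X n).K := fun n z => z.1 n
  have hp : ∀ n, Measurable (p n) := fun n => (measurable_pi_apply n).comp measurable_subtype_coe
  have hψp : ∀ n, ψ n ∘ p (n + 1) = p n := fun n => funext fun z => z.2 n
  have hms : (inferInstance : MeasurableSpace D) =
      ⨆ n, MeasurableSpace.comap (p n) inferInstance := by
    change MeasurableSpace.comap Subtype.val MeasurableSpace.pi = _
    simp_rw [MeasurableSpace.pi, MeasurableSpace.comap_iSup, MeasurableSpace.comap_comp]
    rfl
  let Φ : (∀ n, Word k → (X n).K) → Word k → D := fun x w => r fun n => x n w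
  have hΦ : Measurable Φ := measurable_pi_lambda _ fun w => hr.comp <|
    measurable_pi_lambda _ fun n => (measurable_pi_apply w).comp (measurable_pi_apply n)
  have hPΦ : IsProbabilityMeasure (P.map Φ) := Measure.isProbabilityMeasure_map hΦ.aemeasurable
  have hfac : ∀ n, (P.map Φ).map (fun x w => p n (x w)) = (X n).μ := by
    intro n
    rw [Measure.map_map (measurable_coordMap (hp n)) hΦ, ← hmarg n]
    refine Measure.map_congr ?_
    filter_upwards [hin] with x hx
    funext w
    exact congrArg (fun z : D => z.1 n) (hrD ⟨_, hx w⟩)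
  let Z : System.{u} k :=
    { K := D
      μ := P.map Φ
      stationary := fun φ => by
        have := Measure.isProbabilityMeasure_map (μ := P.map Φ)
          (φ.measurable_act (K := D)).aemeasurable
        refine ext_of_map_coord (fun n => (hψ n).1) hψp hms _ _ fun n => ?_
        rw [hfac n, Measure.map_map (measurable_coordMap (hp n)) φ.measurable_act]
        conv_rhs => rw [← (X n).stationary φ, ← hfac n,
          Measure.map_map φ.measurable_act (measurable_coordMap (hp n))]
        rfl }
  exact ⟨Z, p, hψ, fun n => ⟨hp n, hfac n⟩, hψp, hms⟩

section Sated

variable [NeZero k]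

/-! ### Energies and maximal factors -/

/-- The energy of a set `A` relative to a `σ`-algebra `m`: the squared `L²` norm of the conditional
expectation of `1_A`. -/
noncomputable def System.energy (X : System.{u} k) (A : Set X.K) (m : MeasurableSpace X.K) : ℝ :=
  ∫ x, (X.pt[A.indicator (1 : X.K → ℝ) | m]) x ^ 2 ∂X.pt

theorem System.energy_le_one (X : System.{u} k) (A : Set X.K) {m : MeasurableSpace X.K}
    (hm : m ≤ X.ms) : X.energy A m ≤ 1 := by
  by_cases h : Integrable (A.indicator (1 : X.K → ℝ)) X.pt
  · have hb : ∀ x, ‖A.indicator (1 : X.K → ℝ) x‖ ≤ 1 := fun x => by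
      by_cases hx : x ∈ A <;> simp [hx]
    have h2 : MemLp (A.indicator (1 : X.K → ℝ)) 2 X.pt :=
      MemLp.of_bound h.aestronglyMeasurable 1 (ae_of_all _ hb)
    refine (integral_condExp_sq_le hm h2).trans ?_
    calc ∫ x, A.indicator (1 : X.K → ℝ) x ^ 2 ∂X.pt ≤ ∫ _, (1 : ℝ) ∂X.pt := by
          refine integral_mono h2.integrable_sq (integrable_const _) fun x => ?_
          by_cases hx : x ∈ A <;> simp [hx]
      _ = 1 := by simp
  · simp [System.energy, condExp_of_not_integrable h]

theorem System.memLp_indicator (X : System.{u} k) {A : Set X.K} (hA : MeasurableSet A) :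
    MemLp (A.indicator (1 : X.K → ℝ)) 2 X.pt :=
  memLp_indicator_const 2 hA 1 (by simp)

theorem System.energy_mono (X : System.{u} k) {A : Set X.K} (hA : MeasurableSet A)
    {m m' : MeasurableSpace X.K} (hmm' : m ≤ m') (hm' : m' ≤ X.ms) :
    X.energy A m ≤ X.energy A m' :=
  integral_condExp_sq_mono hmm' hm' (X.memLp_indicator hA)

theorem IsCwFactorMap.energy_comap {X Y : System.{u} k} {π : X.K → Y.K}
    (hπ : IsCwFactorMap X Y π) {A : Set Y.K} (hA : MeasurableSet A) {m : MeasurableSpace Y.K}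
    (hm : m ≤ Y.ms) : X.energy (π ⁻¹' A) (m.comap π) = Y.energy A m :=
  integral_condExp_sq_comp_of_map hπ.1 hπ.map_pt hm
    ((Y.memLp_indicator hA).integrable one_le_two)

/-- The energies of `A` relative to the factors of `X` that lie in `C`. -/
def energies (C : Set (System.{u} k)) (X : System.{u} k) (A : Set X.K) : Set ℝ :=
  {r | ∃ Y ∈ C, ∃ f : X.K → Y.K, IsCwFactorMap X Y f ∧ X.energy A (Y.ms.comap f) = r}

theorem bddAbove_energies (C : Set (System.{u} k)) (X : System.{u} k) (A : Set X.K) :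
    BddAbove (energies C X A) := by
  refine ⟨1, ?_⟩
  rintro _ ⟨Y, -, f, hf, rfl⟩
  exact X.energy_le_one A hf.1.comap_le

theorem IsCwIdempotent.energies_nonempty {C : Set (System.{u} k)} (hC : IsCwIdempotent C)
    (X : System.{u} k) (A : Set X.K) : (energies C X A).Nonempty :=
  ⟨_, _, hC.factor_mem_of_subsingleton X (f := fun _ => PUnit.unit) measurable_const, _,
    X.isCwFactorMap_factor _, rfl⟩

theorem exists_seq_piSystem (α : Type*) [m : MeasurableSpace α]
    [MeasurableSpace.CountablyGenerated α] :
    ∃ A : ℕ → Set α, (∀ n, MeasurableSet (A n)) ∧ IsPiSystem (Set.range A) ∧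
      m = MeasurableSpace.generateFrom (Set.range A) := by
  have hgen : MeasurableSpace.generateFrom
      (generateSetAlgebra (MeasurableSpace.countableGeneratingSet α)) = m := by
    rw [generateFrom_generateSetAlgebra_eq, MeasurableSpace.generateFrom_countableGeneratingSet]
  obtain ⟨A, hA⟩ := (countable_generateSetAlgebra
    (MeasurableSpace.countable_countableGeneratingSet (α := α))).exists_eq_range
    ⟨∅, generateSetAlgebra.empty⟩
  rw [hA] at hgen
  refine ⟨A, fun n => ?_, ?_, hgen.symm⟩
  · rw [← hgen]
    exact MeasurableSpace.measurableSet_generateFrom ⟨n, rfl⟩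
  · rw [← hA]
    exact fun s hs t ht _ => isSetAlgebra_generateSetAlgebra.inter_mem hs ht

/-- If `m'` contains `m` and gives the sets of a generating `π`-system no more energy than `m` does,
then `m'` is contained in `m` up to negligible sets: an `m'`-measurable indicator `g` has vanishing
remainder `g - E(g | m)`, as this is orthogonal to every measurable set. -/
theorem System.exists_ae_eq_of_energy_le (X : System.{u} k) {m m' : MeasurableSpace X.K}
    (hmm' : m ≤ m') (hm' : m' ≤ X.ms) {S : Set (Set X.K)} (hS : IsPiSystem S)
    (hgen : X.ms = MeasurableSpace.generateFrom S)
    (h : ∀ A ∈ S, X.energy A m' ≤ X.energy A m) {A : Set X.K} (hA : MeasurableSet[m'] A) :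
    ∃ B, MeasurableSet[m] B ∧ A =ᵐ[X.pt] B := by
  have hSm : ∀ A ∈ S, MeasurableSet[X.ms] A := fun A hA =>
    hgen ▸ MeasurableSpace.measurableSet_generateFrom hA
  have hm := hmm'.trans hm'
  let g : X.K → ℝ := A.indicator 1
  have hg : StronglyMeasurable[m'] g := stronglyMeasurable_one.indicator hA
  have hg2 : MemLp g 2 X.pt := X.memLp_indicator (hm' _ hA)
  have hh2 : MemLp (fun x => g x - (X.pt[g | m]) x) 2 X.pt := hg2.sub (hg2.condExp one_le_two)
  have h0 : ∀ E, MeasurableSet[X.ms] E → ∫ x in E, (g x - (X.pt[g | m]) x) ∂X.pt = 0 :=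
    setIntegral_eq_zero_of_piSystem (hh2.integrable one_le_two) hS le_rfl hgen
      (integral_sub_condExp_eq_zero hm (hg2.integrable one_le_two))
      fun E hE => setIntegral_sub_condExp_eq_zero (hSm E hE) hmm' hm' (h E hE) hg hg2
  have hae : (fun x => g x - (X.pt[g | m]) x) =ᵐ[X.pt] 0 :=
    (hh2.integrable one_le_two).ae_eq_zero_of_forall_setIntegral_eq_zero fun E hE _ => h0 E hE
  refine ⟨X.pt[g | m] ⁻¹' {1},
    stronglyMeasurable_condExp.measurable (measurableSet_singleton 1), ?_⟩
  filter_upwards [hae] with x hx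
  have hx' : (X.pt[g | m]) x = g x := by
    have : g x - (X.pt[g | m]) x = 0 := hx
    linarith
  refine propext ?_
  change x ∈ A ↔ (X.pt[g | m]) x = 1
  rw [hx']
  by_cases hxA : x ∈ A <;> simp [g, hxA]

/-- Every system has a maximal factor in a cw-idempotent class: join countably many factors whose
energies approach the suprema for all sets of a countable generating `π`-system. -/
theorem IsCwIdempotent.exists_isMaximalCwFactor {C : Set (System.{u} k)} (hC : IsCwIdempotent C)
    (X : System.{u} k) : ∃ (Y : System.{u} k) (ζ : X.K → Y.K), IsMaximalCwFactor C X Y ζ := by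
  obtain ⟨A, hA, hpi, hgen⟩ := exists_seq_piSystem X.K
  have happ : ∀ n : ℕ, ∃ Y ∈ C, ∃ f : X.K → Y.K, IsCwFactorMap X Y f ∧
      sSup (energies C X (A n.unpair.1)) - 1 / ((n.unpair.2 : ℝ) + 1) <
        X.energy (A n.unpair.1) (Y.ms.comap f) := by
    intro n
    obtain ⟨_, ⟨Y, hY, f, hf, rfl⟩, hlt⟩ := exists_lt_of_lt_csSup
      (hC.energies_nonempty X (A n.unpair.1))
      (sub_lt_self (sSup (energies C X (A n.unpair.1)))
        (Nat.one_div_pos_of_nat (n := n.unpair.2) (α := ℝ)))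
    exact ⟨Y, hY, f, hf, hlt⟩
  choose Y hY f hf hlt using happ
  -- `ζ` joins all these factors, so it attains the supremum of the energies of every `A j`.
  have hfm : ∀ n, Measurable (f n) := fun n => (hf n).1
  have hζC := hC.factor_pi_mem X hfm fun n => by rw [(hf n).factor_eq]; exact hY n
  let ζ : X.K → ∀ n, (Y n).K := fun x n => f n x
  have hζ : Measurable ζ := measurable_pi_lambda _ hfm
  have hle : ∀ n, (Y n).ms.comap (f n) ≤ MeasurableSpace.comap ζ inferInstance := fun n =>
    ((measurable_pi_apply n).comp (comap_measurable ζ)).comap_le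
  have hmax : ∀ j, ∀ r ∈ energies C X (A j),
      r ≤ X.energy (A j) (MeasurableSpace.comap ζ inferInstance) := by
    intro j r hr
    refine (le_csSup (bddAbove_energies C X (A j)) hr).trans ?_
    refine le_of_forall_pos_lt_add fun ε hε => ?_
    obtain ⟨b, hb⟩ := exists_nat_one_div_lt hε
    have h1 := hlt (Nat.pair j b)
    have h2 := X.energy_mono (hA j) (hle (Nat.pair j b)) hζ.comap_le
    rw [Nat.unpair_pair] at h1
    dsimp only at h1
    linarith
  refine ⟨X.factor hζ, ζ, hζC, X.isCwFactorMap_factor hζ, fun Y' f' hY' hf' E hE => ?_⟩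
  -- Joining a further factor `f'` to `ζ` stays in `C` and hence gains no energy.
  have hjoin := hC.factor_prodMk_mem X hζ hf'.1 hζC (by rw [hf'.factor_eq]; exact hY')
  let F : X.K → (∀ n, (Y n).K) × Y'.K := fun x => (ζ x, f' x)
  have hF : Measurable F := hζ.prodMk hf'.1
  obtain ⟨_, ⟨B, hB, rfl⟩, hEB⟩ := X.exists_ae_eq_of_energy_le
    (m := MeasurableSpace.comap ζ inferInstance) (m' := MeasurableSpace.comap F inferInstance)
    (measurable_fst.comp (comap_measurable F)).comap_le hF.comap_le hpi hgen
    (by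
      rintro _ ⟨j, rfl⟩
      exact hmax j _ ⟨_, hjoin, F, X.isCwFactorMap_factor hF, rfl⟩)
    (A := f' ⁻¹' E) ((measurable_snd.comp (comap_measurable F)) hE)
  exact ⟨B, hB, hEB⟩

/-- Every maximal factor attains all suprema of energies, although it contains the other factors in
`C` only up to negligible sets. -/
theorem IsMaximalCwFactor.energy_le {C : Set (System.{u} k)} {X Y : System.{u} k} {ζ : X.K → Y.K}
    (h : IsMaximalCwFactor C X Y ζ) {A : Set X.K} (hA : MeasurableSet A) {r : ℝ}
    (hr : r ∈ energies C X A) : r ≤ X.energy A (Y.ms.comap ζ) := by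
  obtain ⟨Y', hY', f, hf, rfl⟩ := hr
  refine integral_condExp_sq_mono_of_ae_le hf.1.comap_le h.2.1.1.comap_le (X.memLp_indicator hA) ?_
  rintro _ ⟨B, hB, rfl⟩
  obtain ⟨D, hD, hBD⟩ := h.2.2 Y' f hY' hf B hB
  exact ⟨_, ⟨D, hD, rfl⟩, hBD⟩

/-- The energies of `A` relative to the factors in `C` of all extensions of `X`. -/
def extEnergies (C : Set (System.{u} k)) (X : System.{u} k) (A : Set X.K) : Set ℝ :=
  {r | ∃ (X' : System.{u} k) (π : X'.K → X.K), IsCwFactorMap X' X π ∧ r ∈ energies C X' (π ⁻¹' A)}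

theorem bddAbove_extEnergies (C : Set (System.{u} k)) (X : System.{u} k) (A : Set X.K) :
    BddAbove (extEnergies C X A) := by
  refine ⟨1, ?_⟩
  rintro _ ⟨X', π, -, Y, -, f, hf, rfl⟩
  exact X'.energy_le_one _ hf.1.comap_le

theorem IsCwIdempotent.extEnergies_nonempty {C : Set (System.{u} k)} (hC : IsCwIdempotent C)
    (X : System.{u} k) (A : Set X.K) : (extEnergies C X A).Nonempty :=
  let ⟨r, hr⟩ := hC.energies_nonempty X A
  ⟨r, X, id, IsCwFactorMap.id X, hr⟩

/-- If `A` gains no energy in extensions of `X`, then in every extension `X'` the set `A` is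
orthogonal to the part of the maximal `C`-factor of `X'` that is not seen by the one of `X`. -/
theorem setIntegral_eq_zero_of_extEnergies_le {C : Set (System.{u} k)} (hC : IsCwIdempotent C)
    {X X' Y Y' : System.{u} k} {π : X'.K → X.K} (hπ : IsCwFactorMap X' X π) {ζ : X.K → Y.K}
    {ζ' : X'.K → Y'.K} (hYC : Y ∈ C) (hζ : IsCwFactorMap X Y ζ) (hYC' : Y' ∈ C)
    (hζ' : IsCwFactorMap X' Y' ζ') {A : Set X.K} (hA : MeasurableSet A)
    (h : ∀ r ∈ extEnergies C X A, r ≤ X.energy A (Y.ms.comap ζ)) {g : X'.K → ℝ}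
    (hg : StronglyMeasurable[Y'.ms.comap ζ'] g) (hg2 : MemLp g 2 X'.pt) :
    ∫ x in π ⁻¹' A, (g x - (X'.pt[g | Y.ms.comap (ζ ∘ π)]) x) ∂X'.pt = 0 := by
  -- `ζ ∘ π` is contained in `ζ'` only up to negligible sets; their joining `F` contains both
  -- exactly.
  let F : X'.K → Y'.K × Y.K := fun x => (ζ' x, ζ (π x))
  have hF : Measurable F := hζ'.1.prodMk (hζ.1.comp hπ.1)
  have hFC : X'.factor hF ∈ C := hC.factor_prodMk_mem X' hζ'.1 (hζ.1.comp hπ.1)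
    (by rw [hζ'.factor_eq]; exact hYC') (by rw [(hζ.comp hπ).factor_eq]; exact hYC)
  refine setIntegral_sub_condExp_eq_zero (m' := MeasurableSpace.comap F inferInstance)
    (hπ.1 hA) (measurable_snd.comp (comap_measurable F)).comap_le hF.comap_le ?_
    (hg.mono (measurable_fst.comp (comap_measurable F)).comap_le) hg2
  have h1 := h _ ⟨X', π, hπ, _, hFC, F, X'.isCwFactorMap_factor hF, rfl⟩
  rw [← hπ.energy_comap hA hζ.1.comap_le, MeasurableSpace.comap_comp] at h1
  exact h1

/-! ### Sated extensions -/

/-- An inverse limit is `C`-sated if the sets that generate the systems of its sequence gain no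
energy in its extensions. -/
theorem IsCwInverseLimit.isCwSated {C : Set (System.{u} k)} (hC : IsCwIdempotent C)
    {Z : System.{u} k} {X : ℕ → System.{u} k} {ψ : ∀ n, (X (n + 1)).K → (X n).K}
    {p : ∀ n, Z.K → (X n).K} (hZ : IsCwInverseLimit Z X ψ p) (S : ∀ n, Set (Set (X n).K))
    (hS : ∀ n, IsPiSystem (S n)) (hgen : ∀ n, (X n).ms = MeasurableSpace.generateFrom (S n))
    (h : ∀ n, ∀ A ∈ S n, ∀ r ∈ extEnergies C Z (p n ⁻¹' A), ∀ (Y : System.{u} k) (ζ : Z.K → Y.K),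
      IsMaximalCwFactor C Z Y ζ → r ≤ Z.energy (p n ⁻¹' A) (Y.ms.comap ζ)) :
    IsCwSated C Z := by
  obtain ⟨hψ, hp, hψp, hms⟩ := hZ
  have hSm : ∀ n, ∀ A ∈ S n, MeasurableSet A := fun n A hA => by
    rw [hgen n]
    exact MeasurableSpace.measurableSet_generateFrom hA
  intro X' π hπ
  refine ⟨hC.exists_isMaximalCwFactor X', fun Y' Y ζ' ζ hζ' hζ => ?_⟩
  have hm : Y.ms.comap (ζ ∘ π) ≤ X'.ms := (hζ.2.1.1.comp hπ.1).comap_le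
  refine relIndep_of_setIntegral_eq_zero hπ.1.comap_le hζ'.2.1.1.comap_le hm
    fun g hg hg2 => ?_
  have hh : Integrable (fun x => g x - (X'.pt[g | Y.ms.comap (ζ ∘ π)]) x) X'.pt :=
    (hg2.integrable one_le_two).sub integrable_condExp
  have huniv := integral_sub_condExp_eq_zero hm (hg2.integrable one_le_two)
  let q : ∀ n, X'.K → (X n).K := fun n => p n ∘ π
  have hq : ∀ n, Measurable (q n) := fun n => (hp n).1.comp hπ.1
  have hmono : Monotone fun n => (X n).ms.comap (q n) :=
    comap_monotone_of_comp_eq (fun n => (hψ n).1) fun n => by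
      rw [← Function.comp_assoc, hψp]
  have hstep : ∀ n, ∀ E, MeasurableSet[(X n).ms.comap (q n)] E →
      ∫ x in E, (g x - (X'.pt[g | Y.ms.comap (ζ ∘ π)]) x) ∂X'.pt = 0 := by
    intro n
    refine setIntegral_eq_zero_of_piSystem hh ((hS n).comap (q n)) (hq n).comap_le ?_ huniv ?_
    · rw [hgen n, MeasurableSpace.comap_generateFrom]
      rfl
    · rintro _ ⟨A, hA, rfl⟩
      exact setIntegral_eq_zero_of_extEnergies_le hC hπ hζ.1 hζ.2.1 hζ'.1 hζ'.2.1
        ((hp n).1 (hSm n A hA)) (fun r hr => h n A hA r hr Y ζ hζ) hg hg2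
  refine setIntegral_eq_zero_of_piSystem hh (isPiSystem_iUnion_measurableSet hmono)
    hπ.1.comap_le ?_ huniv ?_
  · refine Eq.trans ?_ (MeasurableSpace.generateFrom_iUnion_measurableSet
      fun n => (X n).ms.comap (q n)).symm
    rw [hms, MeasurableSpace.comap_iSup]
    simp_rw [MeasurableSpace.comap_comp]
    rfl
  · intro E hE
    obtain ⟨n, hn⟩ := Set.mem_iUnion.1 hE
    exact hstep n E hn

theorem extEnergies_preimage_subset (C : Set (System.{u} k)) {X Z : System.{u} k} {p : Z.K → X.K}
    (hp : IsCwFactorMap Z X p) (A : Set X.K) :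
    extEnergies C Z (p ⁻¹' A) ⊆ extEnergies C X A := by
  rintro r ⟨X', π, hπ, hr⟩
  exact ⟨X', p ∘ π, hp.comp hπ, hr⟩

theorem energies_subset_energies_preimage (C : Set (System.{u} k)) {X Z : System.{u} k}
    {p : Z.K → X.K} (hp : IsCwFactorMap Z X p) {A : Set X.K} (hA : MeasurableSet A) :
    energies C X A ⊆ energies C Z (p ⁻¹' A) := by
  rintro _ ⟨Y, hY, f, hf, rfl⟩
  refine ⟨Y, hY, f ∘ p, hf.comp hp, ?_⟩
  rw [← hp.energy_comap hA hf.1.comap_le, MeasurableSpace.comap_comp]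

theorem exists_extension_energy_gt {C : Set (System.{u} k)} (hC : IsCwIdempotent C)
    (X : System.{u} k) (A : Set X.K) {ε : ℝ} (hε : 0 < ε) :
    ∃ (X' : System.{u} k) (π : X'.K → X.K), IsCwFactorMap X' X π ∧
      ∃ r ∈ energies C X' (π ⁻¹' A), sSup (extEnergies C X A) < r + ε := by
  obtain ⟨r, ⟨X', π, hπ, hr⟩, hlt⟩ :=
    exists_lt_of_lt_csSup (hC.extEnergies_nonempty X A) (sub_lt_self _ hε)
  exact ⟨X', π, hπ, r, hr, by linarith⟩

/-- The inverse limit of the tower of extensions in which the energies of all sets of generating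
sequences are successively driven to their suprema is sated for all classes at once. -/
theorem exists_isCwSated_of_nonempty {I : Type v} [Countable I] [Nonempty I]
    (C : I → Set (System.{u} k)) (hC : ∀ i, IsCwIdempotent (C i))
    (X₀ : System.{u} k) :
    ∃ (X : System.{u} k) (π : X.K → X₀.K),
      IsCwFactorMap X X₀ π ∧ ∀ i, IsCwSated (C i) X := by
  choose gen hgenm hgenpi hgen using fun X : System.{u} k => exists_seq_piSystem X.K
  obtain ⟨e, he⟩ := exists_surjective_nat (I × ℕ × ℕ)
  -- A state is a system `X` with doubly indexed sets of `X.K`: at time `n`, row `m < n` is the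
  -- pulled back generating sequence of the system at time `m`, and the other rows are that of `X`.
  -- At time `n`, the task `e n.unpair.1` is treated, so each task is treated infinitely often.
  let State := Σ X : System.{u} k, ℕ → ℕ → Set X.K
  have hstep : ∀ (n : ℕ) (s : State), ∃ (X' : System.{u} k) (π : X'.K → s.1.K),
      IsCwFactorMap X' s.1 π ∧
      ∃ r ∈ energies (C (e n.unpair.1).1) X'
          (π ⁻¹' s.2 (e n.unpair.1).2.1 (e n.unpair.1).2.2),
        sSup (extEnergies (C (e n.unpair.1).1) s.1 (s.2 (e n.unpair.1).2.1 (e n.unpair.1).2.2)) <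
          r + 1 / ((n : ℝ) + 1) := fun n s =>
    exists_extension_energy_gt (hC _) s.1 _ Nat.one_div_pos_of_nat
  choose E π hπ hr using hstep
  let s : ℕ → State := fun n => Nat.rec ⟨X₀, fun _ => gen X₀⟩
    (fun n s => ⟨E n s, fun m j => if m ≤ n then π n s ⁻¹' s.2 m j else gen (E n s) j⟩) n
  let X : ℕ → System.{u} k := fun n => (s n).1
  let ψ : ∀ n, (X (n + 1)).K → (X n).K := fun n => π n (s n)
  let B : ∀ n, ℕ → ℕ → Set (X n).K := fun n => (s n).2
  have hB : ∀ n m j, B (n + 1) m j = if m ≤ n then ψ n ⁻¹' B n m j else gen (X (n + 1)) j :=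
    fun n m j => rfl
  have hψ : ∀ n, IsCwFactorMap (X (n + 1)) (X n) (ψ n) := fun n => hπ n (s n)
  obtain ⟨Z, p, hZ⟩ := exists_isCwInverseLimit X ψ hψ
  have hBdiag : ∀ n j, B n n j = gen (X n) j := by
    intro n j
    cases n with
    | zero => rfl
    | succ n => rw [hB, if_neg (by omega)]
  have hBp : ∀ m j n, m ≤ n → p n ⁻¹' B n m j = p m ⁻¹' gen (X m) j := by
    intro m j n hmn
    induction n, hmn using Nat.le_induction with
    | base => rw [hBdiag]
    | succ n hmn ih => rw [hB, if_pos hmn, ← Set.preimage_comp, hZ.2.2.1, ih]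
  have hBm : ∀ n m j, m ≤ n → MeasurableSet (B n m j) := by
    intro n m j hmn
    induction n, hmn using Nat.le_induction with
    | base => rw [hBdiag]; exact hgenm _ _
    | succ n hmn ih => rw [hB, if_pos hmn]; exact (hψ n).1 ih
  refine ⟨Z, p 0, hZ.2.1 0, fun i => hZ.isCwSated (hC i) (fun n => Set.range (gen (X n)))
    (fun n => hgenpi _) (fun n => hgen _) ?_⟩
  rintro m _ ⟨j, rfl⟩ r hr' Y ζ hζ
  obtain ⟨a, ha⟩ := he (i, m, j)
  refine le_of_forall_pos_le_add fun ε hε => ?_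
  obtain ⟨b, hb⟩ := exists_nat_one_div_lt hε
  -- A time at which the task `a` is treated, late enough for row `m` to be settled and for the
  -- error to be below `ε`.
  let n := Nat.pair a (max b m)
  have hbn : max b m ≤ n := Nat.right_le_pair a _
  have hmn : m ≤ n := (le_max_right _ _).trans hbn
  obtain ⟨r', hr'C, hlt⟩ := hr n (s n)
  have hn : e n.unpair.1 = (i, m, j) := by rw [Nat.unpair_pair]; exact ha
  rw [hn] at hr'C hlt
  have h1 : r ≤ sSup (extEnergies (C i) (X n) (B n m j)) := by
    refine le_csSup (bddAbove_extEnergies _ _ _) ?_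
    refine extEnergies_preimage_subset (C i) (hZ.2.1 n) _ ?_
    rwa [hBp m j n hmn]
  have h2 : r' ≤ Z.energy (p m ⁻¹' gen (X m) j) (Y.ms.comap ζ) := by
    have hmem := energies_subset_energies_preimage (C i) (hZ.2.1 (n + 1))
      ((hψ n).1 (hBm n m j hmn)) hr'C
    rw [← Set.preimage_comp, hZ.2.2.1, hBp m j n hmn] at hmem
    exact hζ.energy_le ((hZ.2.1 m).1 (hgenm _ _)) hmem
  have h3 : 1 / ((n : ℝ) + 1) ≤ 1 / ((b : ℝ) + 1) :=
    Nat.one_div_le_one_div ((le_max_left _ _).trans hbn)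
  have h4 : sSup (extEnergies (C i) (X n) (B n m j)) < r' + 1 / ((n : ℝ) + 1) := hlt
  linarith

end Sated

end StrongStat

theorem mainTheorem11 {k : ℕ} [NeZero k] {I : Type v} [Countable I]
    (C : I → Set (StrongStat.System.{u} k)) (hC : ∀ i, StrongStat.IsCwIdempotent (C i))
    (X₀ : StrongStat.System.{u} k) :
    ∃ (X : StrongStat.System.{u} k) (π : X.K → X₀.K),
      StrongStat.IsCwFactorMap X X₀ π ∧ ∀ i, StrongStat.IsCwSated (C i) X := by
  cases isEmpty_or_nonempty I
  · exact ⟨X₀, id, StrongStat.IsCwFactorMap.id X₀, isEmptyElim⟩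
  · exact StrongStat.exists_isCwSated_of_nonempty C hC X₀
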